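/- For a graph $G$ on the vertex set $\{1,\dots,n\}$, let $V_T(G)$ be the number of vertices of $G$ that are part of a triangle. Let $\lambda\in(0,\infty)$, and let $G_n$ be the Erdős–Rényi random graph $G(n,p_n)$ with $p_n=\lambda/n$ (for $n\ge\lambda$). For $g\colon[0,1]\to\mathbb{R}$, let $$Z_n(g)=\mathbb{E}\left[\mathrm{e}^{\,n\log n\; g(V_T(G_n)/n)}\right]$$ be the partition function (normalisation constant) of the exponential random graph model $\mathbb{P}_g$ given by $\frac{d\mathbb{P}_g}{d\mathbb{P}}=\frac{1}{Z_n(g)}\,\mathrm{e}^{\,n\log n\; g(V_T(G_n)/n)}$, where $\mathbb{P}$ is the law of $G_n$. Let $g(x)=\beta x^{\alpha}$ with $\alpha\in(0,1)$, $\beta>0$ and $3\alpha\beta<1$. Then, for every $\lambda\in(0,\infty)$, $$\lim_{n\to\infty}\frac{1}{n\log n}\log Z_n(g)=\beta\,(3\alpha\beta)^{-\frac{\alpha}{\alpha-1}}-\tfrac13\,(3\alpha\beta)^{-\frac{1}{\alpha-1}}.$$ -/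

import Mathlib

open MeasureTheory ProbabilityTheory Filter Topology

namespace TriangleERG

/-- The number `V_T(G)` of vertices of `G` that are part of a triangle of `G`. -/
noncomputable def verticesInTriangles {V : Type*} (G : SimpleGraph V) : ℕ :=
  {v : V | ∃ u w : V, G.Adj v u ∧ G.Adj v w ∧ G.Adj u w}.ncard

/-- The edge probability `λ / n`, as an element of the unit interval. The clamping to `[0, 1]` only
has an effect for the finitely many `n` with `λ / n > 1` (for `λ > 0`). -/
noncomputable def edgeProb (lam : ℝ) (n : ℕ) : unitInterval :=
  Set.projIcc 0 1 zero_le_one (lam / n)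

/-- The law of the Erdős–Rényi random graph `G(n, λ / n)` on the vertex set `Fin n`: every pair of
distinct vertices is an edge independently with probability `λ / n`. -/
noncomputable def erdosRenyi (lam : ℝ) (n : ℕ) : Measure (SimpleGraph (Fin n)) :=
  SimpleGraph.binomialRandom (Fin n) (edgeProb lam n)

/-- The partition function `Z_n(g) = 𝔼[exp(n log n · g(V_T(G_n) / n))]` of the exponential random
graph with density `exp(n log n · g(V_T(G) / n)) / Z_n(g)` with respect to the law of the
Erdős–Rényi random graph `G_n = G(n, λ / n)`. -/
noncomputable def partitionFunction (lam : ℝ) (g : ℝ → ℝ) (n : ℕ) : ℝ :=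
  ∫ G, Real.exp (n * Real.log n * g ((verticesInTriangles G : ℝ) / n)) ∂(erdosRenyi lam n)

end TriangleERG

/-!
The value of the limit is `L = β x ^ α - x / 3`, where `x = (3 α β) ^ (1 / (1 - α)) < 1` maximises
`β y ^ α - y / 3`: forcing `y n` vertices into triangles costs a probability
`exp (-(y / 3 + o(1)) n log n)`, the cheapest way being `y n / 3` vertex-disjoint triangles.

*Upper bound.* By concavity, `β y ^ α ≤ L + y / 3` for all `y ≥ 0` (the tangent line at `x`), so
that `Z_n ≤ n ^ (n L) 𝔼[n ^ (V_T / 3)]`, and it suffices that `𝔼[n ^ (V_T / 3)] ≤ exp (O(n))`.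
Take a maximal family `B` of edge-disjoint triangles of `G`. A vertex in a triangle that is not
covered by `B` is joined to both ends of an edge of `B`, by maximality. Choosing such an edge for
each of the `d` uncovered vertices gives a configuration of exactly `3 |B| + 2 d` edges of `G`,
while `V_T ≤ 3 |B| + d` (`exists_configuration`). With `r = n ^ (1 / 3)`, summing the
weights `r ^ (3 |B| + d) p ^ (3 |B| + 2 d)` over all configurations gives at most
`(1 + (r p) ^ 3 exp (3 n r p ^ 2)) ^ (n ^ 3)` (`integral_pow_verticesInTriangles_le`), which is
`exp (O(n))` for `p = λ / n`.

*Lower bound.* Let `m = ⌊x n / 3⌋`. Two permutations of `m` points determine a packing of `m`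
disjoint triangles (`trianglePacking`), and the `(m!) ^ 2` graphs obtained are distinct. The graph
`G_n` equals any given one of them with probability at least `p ^ (3 m) (1 - p) ^ (n choose 2)`, so
that `V_T ≥ 3 m` has probability at least `n ^ (-m) exp (-O(n))`.
-/

namespace TriangleERG

/-! ### Probabilities in the binomial random graph -/

instance measurableSingletonClass_simpleGraph {V : Type*} [Countable V] :
    MeasurableSingletonClass (SimpleGraph V) where
  measurableSet_singleton G := by
    have h : MeasurableSet (SimpleGraph.edgeSet ⁻¹' {G.edgeSet} : Set (SimpleGraph V)) :=
      SimpleGraph.measurable_edgeSet (measurableSet_singleton _)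
    convert h
    ext H
    simp

/-- Only an inequality, because `F` may contain loops, which are never edges of a graph. -/
theorem binomialRandom_real_superset_le {V : Type*} [Finite V] (p : unitInterval)
    (F : Finset (Sym2 V)) :
    (SimpleGraph.binomialRandom V p).real {G | (F : Set (Sym2 V)) ⊆ G.edgeSet} ≤
      (p : ℝ) ^ F.card := by
  classical
  have hle : SimpleGraph.binomialRandom V p {G | (F : Set (Sym2 V)) ⊆ G.edgeSet} ≤
      (unitInterval.toNNReal p : ENNReal) ^ F.card := by
    rw [SimpleGraph.binomialRandom_apply', setBernoulli_apply]
    calc _ ≤ _ := measure_mono (t := Set.pi (F : Set (Sym2 V)) (fun _ => {True})) ?_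
      _ = _ := Measure.infinitePi_pi _ (fun i _ => MeasurableSet.of_discrete)
      _ ≤ ∏ _i ∈ F, (unitInterval.toNNReal p : ENNReal) := by
          refine Finset.prod_le_prod' fun i _ => ?_
          rw [Measure.add_apply, Measure.smul_apply, Measure.smul_apply,
            Measure.dirac_apply' _ (MeasurableSet.of_discrete),
            Measure.dirac_apply' _ (MeasurableSet.of_discrete)]
          by_cases hi : i ∈ (Sym2.diagSetᶜ : Set (Sym2 V)) <;>
            simp [hi, Set.indicator, ENNReal.smul_def]
      _ = _ := by simp
    rintro _ ⟨_, ⟨G, hG, rfl⟩, rfl⟩ e he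
    simpa using hG he
  calc _ ≤ ((unitInterval.toNNReal p : ENNReal) ^ F.card).toReal :=
        ENNReal.toReal_mono (by simp) hle
    _ = _ := by simp

theorem binomialRandom_real_ge_card_mul {V : Type*} [Finite V] (p : unitInterval) (k : ℕ)
    (S : Finset (SimpleGraph V)) (hS : ∀ G ∈ S, G.edgeSet.ncard ≤ k) :
    S.card * ((p : ℝ) ^ k * (1 - p : ℝ) ^ (Nat.card V).choose 2) ≤
      (SimpleGraph.binomialRandom V p).real S := by
  rw [← sum_measureReal_singleton, ← nsmul_eq_mul]
  refine Finset.card_nsmul_le_sum _ _ _ fun G hG => ?_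
  have h0 := p.2.1
  have h1 := p.2.2
  simp only [measureReal_def, SimpleGraph.binomialRandom_singleton, ENNReal.toReal_mul,
    ENNReal.toReal_pow, ENNReal.coe_toReal, unitInterval.coe_toNNReal, unitInterval.coe_symm_eq]
  exact mul_le_mul (pow_le_pow_of_le_one h0 h1 (hS G hG))
    (pow_le_pow_of_le_one (by linarith) (by linarith) (Nat.sub_le _ _))
    (pow_nonneg (by linarith) _) (by positivity)

/-! ### Configurations of triangles and attached vertices -/

section Cover

variable {V : Type*} [DecidableEq V]

/-- The three pairs of entries of a triple `(a, b, c)`, each listed in one orientation. -/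
def trianglePairs (t : V × V × V) : Finset (V × V) :=
  {(t.1, t.2.1), (t.1, t.2.2), (t.2.1, t.2.2)}

/-- The edge set `{ab, ac, bc}` of the triangle on the vertices `a`, `b`, `c`. -/
def triangleEdges (t : V × V × V) : Finset (Sym2 V) :=
  {s(t.1, t.2.1), s(t.1, t.2.2), s(t.2.1, t.2.2)}

/-- The two edges joining `v` to the endpoints of a pair; no edges if no pair is given. -/
def attachingEdges (v : V) (o : Option (V × V)) : Finset (Sym2 V) :=
  o.elim ∅ fun q => {s(v, q.1), s(v, q.2)}

/-- The edges of the configuration consisting of the triangles in `B` together with, for each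
vertex `v` with `f v = some (u, w)`, the two edges `vu` and `vw`. -/
def configurationEdges [Fintype V] (B : Finset (V × V × V)) (f : V → Option (V × V)) :
    Finset (Sym2 V) :=
  B.biUnion triangleEdges ∪ Finset.univ.biUnion fun v => attachingEdges v (f v)

theorem card_biUnion_trianglePairs_le (B : Finset (V × V × V)) :
    (B.biUnion trianglePairs).card ≤ 3 * B.card := by
  rw [mul_comm]
  exact Finset.card_biUnion_le_card_mul _ _ _ fun t _ => Finset.card_le_three

/-- The structural fact behind the upper bound. The triangles `B` are a maximal edge-disjoint family
of triangles of `G`, and `f` assigns to every vertex in a triangle of `G` not covered by `B` an edge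
of `B` to whose endpoints it is joined. The edges of the configuration are pairwise distinct, which
makes its probability as small as `p ^ (3 |B| + 2 |supp f|)`. -/
theorem exists_configuration [Fintype V] (G : SimpleGraph V) :
    ∃ (B : Finset (V × V × V)) (f : V → Option (V × V)),
      (∀ v, f v ∈ (B.biUnion trianglePairs).insertNone) ∧
      (configurationEdges B f : Set (Sym2 V)) ⊆ G.edgeSet ∧
      (configurationEdges B f).card =
        3 * B.card + 2 * (Finset.univ.filter fun v => f v ≠ none).card ∧
      verticesInTriangles G ≤ 3 * B.card + (Finset.univ.filter fun v => f v ≠ none).card := by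
  classical
  let P : Finset (V × V × V) → Prop := fun B =>
    (∀ t ∈ B, G.Adj t.1 t.2.1 ∧ G.Adj t.1 t.2.2 ∧ G.Adj t.2.1 t.2.2) ∧
      (B : Set (V × V × V)).PairwiseDisjoint triangleEdges
  obtain ⟨B, -, hB⟩ := Finite.exists_le_maximal (show P ∅ by simp [P])
  obtain ⟨hadj, hdisj⟩ := hB.prop
  set T : Finset V := Finset.univ.filter fun v => ∃ u w, G.Adj v u ∧ G.Adj v w ∧ G.Adj u w
    with hT
  -- `T` is the set counted by `V_T(G)`, and `U` the set of vertices covered by `B`.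
  set U : Finset V := B.biUnion fun t => {t.1, t.2.1, t.2.2} with hU
  have hUcard : U.card ≤ 3 * B.card := by
    rw [mul_comm]
    exact Finset.card_biUnion_le_card_mul _ _ _ fun t _ => Finset.card_le_three
  have hpairs : ∀ q ∈ B.biUnion trianglePairs, q.1 ∈ U ∧ q.2 ∈ U ∧ q.1 ≠ q.2 := by
    intro q hq
    obtain ⟨t, ht, hq⟩ := Finset.mem_biUnion.1 hq
    obtain ⟨h1, h2, h3⟩ := hadj t ht
    have hmem : ∀ x, x = t.1 ∨ x = t.2.1 ∨ x = t.2.2 → x ∈ U := fun x hx =>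
      Finset.mem_biUnion.2 ⟨t, ht, by simpa using hx⟩
    simp only [trianglePairs, Finset.mem_insert, Finset.mem_singleton] at hq
    rcases hq with rfl | rfl | rfl
    · exact ⟨hmem _ (by simp), hmem _ (by simp), h1.ne⟩
    · exact ⟨hmem _ (by simp), hmem _ (by simp), h2.ne⟩
    · exact ⟨hmem _ (by simp), hmem _ (by simp), h3.ne⟩
  have hedge : ∀ e ∈ B.biUnion triangleEdges, ∃ q ∈ B.biUnion trianglePairs,
      e = s(q.1, q.2) := by
    intro e he
    obtain ⟨t, ht, he⟩ := Finset.mem_biUnion.1 he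
    simp only [triangleEdges, Finset.mem_insert, Finset.mem_singleton] at he
    have hmem : ∀ q ∈ trianglePairs t, q ∈ B.biUnion trianglePairs := fun q hq =>
      Finset.mem_biUnion.2 ⟨t, ht, hq⟩
    rcases he with rfl | rfl | rfl
    · exact ⟨(t.1, t.2.1), hmem _ (by simp [trianglePairs]), rfl⟩
    · exact ⟨(t.1, t.2.2), hmem _ (by simp [trianglePairs]), rfl⟩
    · exact ⟨(t.2.1, t.2.2), hmem _ (by simp [trianglePairs]), rfl⟩
  -- By maximality of `B`, a triangle through a vertex `v` outside `U` shares an edge with a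
  -- triangle of `B`; this edge avoids `v`, so it is the edge opposite to `v`.
  have hopp : ∀ v ∈ T, v ∉ U → ∃ q ∈ B.biUnion trianglePairs, G.Adj v q.1 ∧ G.Adj v q.2 := by
    intro v hvT hvU
    obtain ⟨u, w, hvu, hvw, huw⟩ := (Finset.mem_filter.1 hvT).2
    by_contra hno
    have hnew : ∀ t ∈ B, Disjoint (triangleEdges (v, u, w)) (triangleEdges t) := by
      intro t ht
      rw [Finset.disjoint_left]
      intro e he het
      obtain ⟨q, hq, rfl⟩ := hedge e (Finset.mem_biUnion.2 ⟨t, ht, het⟩)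
      obtain ⟨hq1, hq2, -⟩ := hpairs q hq
      have hv1 : v ≠ q.1 := fun h => hvU (h ▸ hq1)
      have hv2 : v ≠ q.2 := fun h => hvU (h ▸ hq2)
      refine hno ⟨q, hq, ?_⟩
      simp only [triangleEdges, Finset.mem_insert, Finset.mem_singleton, Sym2.eq_iff] at he
      rcases he with (⟨h, -⟩ | ⟨-, h⟩) | (⟨h, -⟩ | ⟨-, h⟩) | (⟨h, h'⟩ | ⟨h, h'⟩)
      · exact absurd h.symm hv1
      · exact absurd h.symm hv2
      · exact absurd h.symm hv1
      · exact absurd h.symm hv2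
      · rw [h, h']; exact ⟨hvu, hvw⟩
      · rw [h, h']; exact ⟨hvw, hvu⟩
    have hP : P (insert (v, u, w) B) := by
      refine ⟨?_, ?_⟩
      · intro t ht
        rcases Finset.mem_insert.1 ht with rfl | ht
        · exact ⟨hvu, hvw, huw⟩
        · exact hadj t ht
      · rw [Finset.coe_insert]
        exact hdisj.insert fun t ht _ => hnew t ht
    have hin : (v, u, w) ∈ B := hB.le_of_ge hP (Finset.subset_insert _ _)
      (Finset.mem_insert_self _ _)
    exact hvU (Finset.mem_biUnion.2 ⟨_, hin, by simp⟩)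
  have hchoice : ∀ v, ∃ o : Option (V × V), (o ≠ none ↔ v ∈ T ∧ v ∉ U) ∧
      ∀ q, o = some q → q ∈ B.biUnion trianglePairs ∧ G.Adj v q.1 ∧ G.Adj v q.2 := by
    intro v
    by_cases hv : v ∈ T ∧ v ∉ U
    · obtain ⟨q, hq, hq'⟩ := hopp v hv.1 hv.2
      refine ⟨some q, by simp [hv], ?_⟩
      rintro _ ⟨⟩
      exact ⟨hq, hq'⟩
    · exact ⟨none, by simp [hv], by simp⟩
  choose f hf hfq using hchoice
  have hsupp : (Finset.univ.filter fun v => f v ≠ none) = T \ U := by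
    ext v
    simp only [Finset.mem_filter, Finset.mem_univ, true_and, hf, Finset.mem_sdiff]
  have hattach : ∀ v, ∀ e ∈ attachingEdges v (f v), v ∉ U ∧ ∃ x ∈ U, G.Adj v x ∧ e = s(v, x) := by
    intro v e he
    rcases hfv : f v with _ | q
    · simp [hfv, attachingEdges] at he
    · obtain ⟨hq, h1, h2⟩ := hfq v q hfv
      obtain ⟨hq1, hq2, -⟩ := hpairs q hq
      refine ⟨((hf v).1 (by simp [hfv])).2, ?_⟩
      simp only [hfv, attachingEdges, Option.elim_some, Finset.mem_insert,
        Finset.mem_singleton] at he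
      rcases he with rfl | rfl
      · exact ⟨_, hq1, h1, rfl⟩
      · exact ⟨_, hq2, h2, rfl⟩
  refine ⟨B, f, ?_, ?_, ?_, ?_⟩
  · intro v
    rw [Finset.mem_insertNone]
    intro q hq
    exact (hfq v q hq).1
  · intro e he
    rcases Finset.mem_union.1 (Finset.mem_coe.1 he) with he | he
    · obtain ⟨t, ht, he⟩ := Finset.mem_biUnion.1 he
      obtain ⟨h1, h2, h3⟩ := hadj t ht
      simp only [triangleEdges, Finset.mem_insert, Finset.mem_singleton] at he
      rcases he with rfl | rfl | rfl
      · exact h1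
      · exact h2
      · exact h3
    · obtain ⟨v, -, he⟩ := Finset.mem_biUnion.1 he
      obtain ⟨-, x, -, hx, rfl⟩ := hattach v e he
      exact hx
  · have hdisj₁ : Disjoint (B.biUnion triangleEdges)
        (Finset.univ.biUnion fun v => attachingEdges v (f v)) := by
      rw [Finset.disjoint_left]
      intro e he he'
      obtain ⟨v, -, he'⟩ := Finset.mem_biUnion.1 he'
      obtain ⟨hv, x, -, -, rfl⟩ := hattach v e he'
      obtain ⟨q, hq, hqe⟩ := hedge _ he
      obtain ⟨hq1, hq2, -⟩ := hpairs q hq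
      rcases Sym2.eq_iff.1 hqe with ⟨h, -⟩ | ⟨h, -⟩
      · exact hv (h ▸ hq1)
      · exact hv (h ▸ hq2)
    have hdisj₂ : ((Finset.univ : Finset V) : Set V).PairwiseDisjoint
        fun v => attachingEdges v (f v) := by
      intro v _ v' _ hvv'
      rw [Function.onFun, Finset.disjoint_left]
      intro e he he'
      obtain ⟨hv, x, hx, -, rfl⟩ := hattach v e he
      obtain ⟨hv', x', hx', -, h⟩ := hattach v' _ he'
      rcases Sym2.eq_iff.1 h with ⟨h, -⟩ | ⟨h, -⟩
      · exact hvv' h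
      · exact hv (h ▸ hx')
    rw [configurationEdges, Finset.card_union_of_disjoint hdisj₁, Finset.card_biUnion hdisj,
      Finset.card_biUnion hdisj₂]
    congr 1
    · rw [Finset.sum_const_nat (m := 3), mul_comm]
      intro t ht
      obtain ⟨h1, h2, h3⟩ := hadj t ht
      rw [triangleEdges, Finset.card_eq_three]
      refine ⟨_, _, _, ?_, ?_, ?_, rfl⟩ <;> rw [Ne, Sym2.eq_iff]
      · rintro (⟨-, h⟩ | ⟨h, -⟩)
        · exact h3.ne h
        · exact h2.ne h
      · rintro (⟨h, -⟩ | ⟨h, -⟩)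
        · exact h1.ne h
        · exact h2.ne h
      · rintro (⟨h, -⟩ | ⟨h, -⟩)
        · exact h1.ne h
        · exact h2.ne h
    · have hcard : ∀ v, (attachingEdges v (f v)).card = if f v ≠ none then 2 else 0 := by
        intro v
        rcases hfv : f v with _ | q
        · simp [attachingEdges]
        · have hne := (hpairs q (hfq v q hfv).1).2.2
          simp only [attachingEdges, Option.elim_some, ne_eq, reduceCtorEq, not_false_eq_true,
            if_true]
          refine Finset.card_pair ?_
          rw [Ne, Sym2.congr_right]
          exact hne
      simp only [hcard]
      rw [← Finset.sum_filter, Finset.sum_const, smul_eq_mul, mul_comm]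
  · have hVT : verticesInTriangles G = T.card := by
      rw [verticesInTriangles, ← Set.ncard_coe_finset]
      congr 1
      ext v
      simp [hT]
    rw [hVT, hsupp]
    have := Finset.card_le_card_sdiff_add_card (s := T) (t := U)
    omega

end Cover

/-! ### The exponential moment of the number of vertices in triangles -/

/-- Generating function for the choice, for some of the elements of `V`, of an element of `s`, where
`y` marks the elements of `V` for which a choice is made. -/
theorem sum_piFinset_insertNone_pow_card {V ι R : Type*} [Fintype V] [DecidableEq V]
    [CommSemiring R] (s : Finset ι) (y : R) :
    ∑ f ∈ Fintype.piFinset fun _ : V => s.insertNone,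
        y ^ (Finset.univ.filter fun v => f v ≠ none).card =
      (1 + s.card * y) ^ Fintype.card V := by
  classical
  have h : ∀ f : V → Option ι, y ^ (Finset.univ.filter fun v => f v ≠ none).card =
      ∏ v, (f v).elim 1 fun _ => y := by
    intro f
    rw [← Finset.prod_const, Finset.prod_filter]
    refine Finset.prod_congr rfl fun v _ => ?_
    rcases f v with _ | _ <;> simp
  simp only [h]
  rw [← Finset.prod_univ_sum (fun _ : V => s.insertNone) fun _ o => o.elim 1 fun _ => y]
  simp [Finset.sum_insertNone]

/-- First moment bound over all configurations: a factor `(r p) ^ 3` for each triangle, and a factor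
`1 + 3 |B| r p ^ 2` for each vertex. The latter factors together are at most
`exp (3 r p ^ 2 |V|) ^ |B|`, so they only change the weight of each triangle, and the sum over all
sets `B` of triples is a binomial sum. -/
theorem integral_pow_verticesInTriangles_le {V : Type*} [Fintype V] (p : unitInterval) {r : ℝ}
    (hr : 1 ≤ r) :
    ∫ G, r ^ verticesInTriangles G ∂(SimpleGraph.binomialRandom V p) ≤
      (1 + (r * p) ^ 3 * Real.exp (3 * Fintype.card V * (r * (p : ℝ) ^ 2))) ^
        (Fintype.card V ^ 3) := by
  classical
  have hp0 : (0 : ℝ) ≤ p := p.2.1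
  have hr0 : 0 ≤ r := by linarith
  set μ := SimpleGraph.binomialRandom V p
  set y : ℝ := r * (p : ℝ) ^ 2 with hy
  have hy0 : 0 ≤ y := by positivity
  let Φ : Finset (V × V × V) → Finset (V → Option (V × V)) := fun B =>
    Fintype.piFinset fun _ => (B.biUnion trianglePairs).insertNone
  let k : (V → Option (V × V)) → ℕ := fun f => (Finset.univ.filter fun v => f v ≠ none).card
  let w : Finset (V × V × V) → (V → Option (V × V)) → ℝ := fun B f =>
    if (configurationEdges B f).card = 3 * B.card + 2 * k f then r ^ (3 * B.card + k f) else 0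
  let S : Finset (V × V × V) → (V → Option (V × V)) → Set (SimpleGraph V) := fun B f =>
    {G | (configurationEdges B f : Set (Sym2 V)) ⊆ G.edgeSet}
  have hw0 : ∀ B f, 0 ≤ w B f := fun B f => by
    simp only [w]; split_ifs <;> positivity
  have hpt : ∀ G : SimpleGraph V, r ^ verticesInTriangles G ≤
      ∑ B, ∑ f ∈ Φ B, (S B f).indicator (fun _ => w B f) G := by
    intro G
    obtain ⟨B, f, hf, hsub, hcard, hle⟩ := exists_configuration G
    have hnn : ∀ B f, 0 ≤ (S B f).indicator (fun _ => w B f) G := fun B f =>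
      Set.indicator_nonneg (fun _ _ => hw0 B f) G
    calc r ^ verticesInTriangles G ≤ r ^ (3 * B.card + k f) := pow_le_pow_right₀ hr hle
      _ = (S B f).indicator (fun _ => w B f) G := by
          rw [Set.indicator_of_mem (show G ∈ S B f from hsub)]
          simp only [w]
          rw [if_pos hcard]
      _ ≤ ∑ f ∈ Φ B, (S B f).indicator (fun _ => w B f) G :=
          Finset.single_le_sum (f := fun f => (S B f).indicator (fun _ => w B f) G)
            (fun f _ => hnn B f) (Fintype.mem_piFinset.2 hf)
      _ ≤ _ := Finset.single_le_sum
            (f := fun B => ∑ f ∈ Φ B, (S B f).indicator (fun _ => w B f) G)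
            (fun B _ => Finset.sum_nonneg fun f _ => hnn B f) (Finset.mem_univ B)
  calc ∫ G, r ^ verticesInTriangles G ∂μ
      ≤ ∫ G, ∑ B, ∑ f ∈ Φ B, (S B f).indicator (fun _ => w B f) G ∂μ :=
        integral_mono .of_finite .of_finite hpt
    _ = ∑ B, ∑ f ∈ Φ B, μ.real (S B f) * w B f := by
        rw [integral_finsetSum _ fun _ _ => .of_finite]
        refine Finset.sum_congr rfl fun B _ => ?_
        rw [integral_finsetSum _ fun _ _ => .of_finite]
        refine Finset.sum_congr rfl fun f _ => ?_
        rw [integral_indicator_const _ (Set.toFinite _).measurableSet, smul_eq_mul]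
    _ ≤ ∑ B : Finset (V × V × V), ∑ f ∈ Φ B, ((r * p) ^ 3) ^ B.card * y ^ k f := by
        refine Finset.sum_le_sum fun B _ => Finset.sum_le_sum fun f _ => ?_
        by_cases hc : (configurationEdges B f).card = 3 * B.card + 2 * k f
        · have h := binomialRandom_real_superset_le p (configurationEdges B f)
          calc μ.real (S B f) * w B f
              ≤ (p : ℝ) ^ (configurationEdges B f).card * w B f :=
                mul_le_mul_of_nonneg_right h (hw0 B f)
            _ = _ := by
                simp only [w]
                rw [if_pos hc, hc, hy]
                ring
        · simp only [w]
          rw [if_neg hc, mul_zero]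
          positivity
    _ = ∑ B : Finset (V × V × V),
          ((r * p) ^ 3) ^ B.card * (1 + (B.biUnion trianglePairs).card * y) ^ Fintype.card V := by
        refine Finset.sum_congr rfl fun B _ => ?_
        rw [← Finset.mul_sum, ← sum_piFinset_insertNone_pow_card]
    _ ≤ ∑ B : Finset (V × V × V), ((r * p) ^ 3 * Real.exp (3 * Fintype.card V * y)) ^ B.card := by
        refine Finset.sum_le_sum fun B _ => ?_
        rw [mul_pow ((r * p : ℝ) ^ 3)]
        refine mul_le_mul_of_nonneg_left ?_ (by positivity)
        have h3 : ((B.biUnion trianglePairs).card : ℝ) ≤ 3 * B.card := by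
          exact_mod_cast card_biUnion_trianglePairs_le B
        calc (1 + (B.biUnion trianglePairs).card * y) ^ Fintype.card V
            ≤ Real.exp (3 * B.card * y) ^ Fintype.card V := by
              refine pow_le_pow_left₀ (by positivity) ?_ _
              calc _ ≤ 3 * B.card * y + 1 := by
                    linarith [mul_le_mul_of_nonneg_right h3 hy0]
                _ ≤ _ := Real.add_one_le_exp _
          _ = _ := by
              rw [← Real.exp_nat_mul, ← Real.exp_nat_mul]
              ring_nf
    _ = _ := by
        have h := Fintype.sum_pow_mul_eq_add_pow (V × V × V)
          ((r * p) ^ 3 * Real.exp (3 * Fintype.card V * y)) (1 : ℝ)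
        simp only [one_pow, mul_one] at h
        rw [h, add_comm]
        congr 1
        simp only [Fintype.card_prod]
        ring

/-! ### Packings of disjoint triangles -/

section Packing

variable {V : Type*} {m : ℕ}

/-- The graph consisting of the `m` vertex-disjoint triangles on the vertices
`e (0, i)`, `e (1, σ i)`, `e (2, τ i)`. -/
def trianglePacking (e : Fin 3 × Fin m ↪ V) (στ : Equiv.Perm (Fin m) × Equiv.Perm (Fin m)) :
    SimpleGraph V :=
  SimpleGraph.fromEdgeSet {x | ∃ i, x = s(e (0, i), e (1, στ.1 i)) ∨
    x = s(e (0, i), e (2, στ.2 i)) ∨ x = s(e (1, στ.1 i), e (2, στ.2 i))}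

theorem trianglePacking_adj_zero_one (e : Fin 3 × Fin m ↪ V)
    (στ : Equiv.Perm (Fin m) × Equiv.Perm (Fin m)) (i j : Fin m) :
    (trianglePacking e στ).Adj (e (0, i)) (e (1, j)) ↔ j = στ.1 i := by
  simp [trianglePacking, e.injective.eq_iff]

theorem trianglePacking_adj_zero_two (e : Fin 3 × Fin m ↪ V)
    (στ : Equiv.Perm (Fin m) × Equiv.Perm (Fin m)) (i j : Fin m) :
    (trianglePacking e στ).Adj (e (0, i)) (e (2, j)) ↔ j = στ.2 i := by
  simp [trianglePacking, e.injective.eq_iff]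

theorem trianglePacking_injective (e : Fin 3 × Fin m ↪ V) :
    Function.Injective (trianglePacking e) := by
  intro a b h
  ext i
  · have := (trianglePacking_adj_zero_one e a i (a.1 i)).2 rfl
    rw [h, trianglePacking_adj_zero_one] at this
    rw [this]
  · have := (trianglePacking_adj_zero_two e a i (a.2 i)).2 rfl
    rw [h, trianglePacking_adj_zero_two] at this
    rw [this]

theorem ncard_edgeSet_trianglePacking_le (e : Fin 3 × Fin m ↪ V)
    (στ : Equiv.Perm (Fin m) × Equiv.Perm (Fin m)) :
    (trianglePacking e στ).edgeSet.ncard ≤ 3 * m := by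
  classical
  let F : Finset (Sym2 V) := Finset.univ.biUnion fun i => {s(e (0, i), e (1, στ.1 i)),
    s(e (0, i), e (2, στ.2 i)), s(e (1, στ.1 i), e (2, στ.2 i))}
  have hsub : (trianglePacking e στ).edgeSet ⊆ F := by
    intro x hx
    rw [trianglePacking, SimpleGraph.edgeSet_fromEdgeSet] at hx
    simpa [F] using hx.1
  calc _ ≤ (F : Set (Sym2 V)).ncard := Set.ncard_le_ncard hsub
    _ = F.card := Set.ncard_coe_finset F
    _ ≤ (Finset.univ : Finset (Fin m)).card * 3 :=
        Finset.card_biUnion_le_card_mul _ _ _ fun _ _ => Finset.card_le_three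
    _ = 3 * m := by rw [Finset.card_univ, Fintype.card_fin, mul_comm]

theorem le_verticesInTriangles_trianglePacking [Finite V] (e : Fin 3 × Fin m ↪ V)
    (στ : Equiv.Perm (Fin m) × Equiv.Perm (Fin m)) :
    3 * m ≤ verticesInTriangles (trianglePacking e στ) := by
  have hadj : ∀ i, (trianglePacking e στ).Adj (e (0, i)) (e (1, στ.1 i)) ∧
      (trianglePacking e στ).Adj (e (0, i)) (e (2, στ.2 i)) ∧
      (trianglePacking e στ).Adj (e (1, στ.1 i)) (e (2, στ.2 i)) := by
    intro i
    refine ⟨(trianglePacking_adj_zero_one e στ i _).2 rfl,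
      (trianglePacking_adj_zero_two e στ i _).2 rfl, ?_⟩
    rw [trianglePacking, SimpleGraph.fromEdgeSet_adj]
    exact ⟨⟨i, Or.inr (Or.inr rfl)⟩, by simp [e.injective.eq_iff]⟩
  calc 3 * m = (Set.range e).ncard := by
        rw [← Set.image_univ, Set.ncard_image_of_injective _ e.injective, Set.ncard_univ,
          Nat.card_prod, Nat.card_fin, Nat.card_fin]
    _ ≤ _ := by
        refine Set.ncard_le_ncard ?_ (Set.toFinite _)
        rintro _ ⟨⟨k, j⟩, rfl⟩
        fin_cases k
        · obtain ⟨h1, h2, h3⟩ := hadj j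
          exact ⟨_, _, h1, h2, h3⟩
        · obtain ⟨i, rfl⟩ := στ.1.surjective j
          obtain ⟨h1, h2, h3⟩ := hadj i
          exact ⟨_, _, h1.symm, h3, h2⟩
        · obtain ⟨i, rfl⟩ := στ.2.surjective j
          obtain ⟨h1, h2, h3⟩ := hadj i
          exact ⟨_, _, h2.symm, h3.symm, h1⟩

/-- The event contains the `(m!) ^ 2` distinct triangle packings; each of them has at most
`3 m` edges and hence at least the stated probability. -/
theorem binomialRandom_real_le_verticesInTriangles_ge [Fintype V] (p : unitInterval)
    (hm : 3 * m ≤ Fintype.card V) :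
    (m.factorial : ℝ) ^ 2 * ((p : ℝ) ^ (3 * m) * (1 - p : ℝ) ^ (Fintype.card V).choose 2) ≤
      (SimpleGraph.binomialRandom V p).real {G | 3 * m ≤ verticesInTriangles G} := by
  classical
  obtain ⟨e⟩ : Nonempty (Fin 3 × Fin m ↪ V) := Function.Embedding.nonempty_of_card_le (by simpa)
  let S : Finset (SimpleGraph V) := Finset.univ.map ⟨_, trianglePacking_injective e⟩
  have hcard : (S.card : ℝ) = (m.factorial : ℝ) ^ 2 := by
    simp [S, Fintype.card_perm, sq]
  have h := binomialRandom_real_ge_card_mul p (3 * m) S (by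
    intro G hG
    obtain ⟨στ, -, rfl⟩ := Finset.mem_map.1 hG
    exact ncard_edgeSet_trianglePacking_le e στ)
  rw [hcard, Nat.card_eq_fintype_card] at h
  refine h.trans (measureReal_mono ?_)
  intro G hG
  obtain ⟨στ, -, rfl⟩ := Finset.mem_map.1 (Finset.mem_coe.1 hG)
  exact le_verticesInTriangles_trianglePacking e στ

end Packing

/-! ### Bounds on the partition function -/

theorem coe_edgeProb {lam : ℝ} (hlam : 0 < lam) {n : ℕ} (hn : lam ≤ n) :
    (edgeProb lam n : ℝ) = lam / n := by
  have hn0 : (0 : ℝ) < n := hlam.trans_le hn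
  rw [edgeProb, Set.projIcc_of_mem _ ⟨by positivity, (div_le_one hn0).2 hn⟩]

theorem partitionFunction_pos (lam : ℝ) (g : ℝ → ℝ) (n : ℕ) : 0 < partitionFunction lam g n := by
  have : IsProbabilityMeasure (erdosRenyi lam n) := by unfold erdosRenyi; infer_instance
  exact integral_exp_pos .of_finite

/-- The bound `𝔼[n ^ (V_T / 3)] ≤ exp (C n)`, whose right-hand side is negligible on the scale
`exp (n log n)`. -/
theorem integral_natCast_pow_third_le {lam : ℝ} (hlam : 0 < lam) {n : ℕ} (hn : lam ≤ n) :
    ∫ G, Real.exp (Real.log n / 3) ^ verticesInTriangles G ∂(erdosRenyi lam n) ≤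
      Real.exp (lam ^ 3 * Real.exp (3 * lam ^ 2) * n) := by
  have hn0 : (0 : ℝ) < n := hlam.trans_le hn
  have hn1 : (1 : ℝ) ≤ n := by
    rw [Nat.one_le_cast]
    exact Nat.cast_pos.1 hn0
  have hlog : 0 ≤ Real.log n := Real.log_nonneg hn1
  set r := Real.exp (Real.log n / 3) with hr
  have hr1 : 1 ≤ r := Real.one_le_exp (by positivity)
  have hr3 : r ^ 3 = n := by
    rw [hr, ← Real.exp_nat_mul, Nat.cast_ofNat, mul_div_cancel₀ _ three_ne_zero, Real.exp_log hn0]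
  have hrn : r ≤ n := by
    rw [← hr3]
    exact le_self_pow₀ hr1 three_ne_zero
  have h := integral_pow_verticesInTriangles_le (V := Fin n) (edgeProb lam n) hr1
  rw [coe_edgeProb hlam hn, Fintype.card_fin] at h
  have hA : (r * (lam / n)) ^ 3 = lam ^ 3 / n ^ 2 := by
    rw [mul_pow, hr3]
    field_simp
  have hE : 3 * n * (r * (lam / n) ^ 2) ≤ 3 * lam ^ 2 := by
    have h1 : 3 * n * (r * (lam / n) ^ 2) = 3 * lam ^ 2 * (r / n) := by field_simp
    rw [h1]
    exact mul_le_of_le_one_right (by positivity) ((div_le_one hn0).2 hrn)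
  calc _ ≤ _ := h
    _ ≤ Real.exp (lam ^ 3 / n ^ 2 * Real.exp (3 * lam ^ 2)) ^ n ^ 3 := by
        refine pow_le_pow_left₀ (by positivity) ?_ _
        rw [hA, add_comm]
        refine le_trans ?_ (Real.add_one_le_exp _)
        gcongr
    _ = _ := by
        rw [← Real.exp_nat_mul]
        congr 1
        push_cast
        field_simp

theorem log_partitionFunction_le {lam L : ℝ} {g : ℝ → ℝ} (hlam : 0 < lam)
    (hg : ∀ x, 0 ≤ x → g x ≤ L + x / 3) {n : ℕ} (hn : lam ≤ n) :
    Real.log (partitionFunction lam g n) ≤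
      n * Real.log n * L + lam ^ 3 * Real.exp (3 * lam ^ 2) * n := by
  have : IsProbabilityMeasure (erdosRenyi lam n) := by unfold erdosRenyi; infer_instance
  have hn0 : (0 : ℝ) < n := hlam.trans_le hn
  have hlog : 0 ≤ Real.log n := Real.log_nonneg (by
    rw [Nat.one_le_cast]
    exact Nat.cast_pos.1 hn0)
  rw [Real.log_le_iff_le_exp (partitionFunction_pos lam g n), Real.exp_add]
  calc partitionFunction lam g n
      ≤ ∫ G, Real.exp (n * Real.log n * L) * Real.exp (Real.log n / 3) ^ verticesInTriangles G
          ∂(erdosRenyi lam n) := by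
        refine integral_mono .of_finite .of_finite fun G => ?_
        simp only
        rw [← Real.exp_nat_mul, ← Real.exp_add, Real.exp_le_exp]
        calc _ ≤ n * Real.log n * (L + (verticesInTriangles G : ℝ) / n / 3) :=
              mul_le_mul_of_nonneg_left (hg _ (by positivity)) (by positivity)
          _ = _ := by field_simp
    _ ≤ _ := by
        rw [integral_const_mul]
        exact mul_le_mul_of_nonneg_left (integral_natCast_pow_third_le hlam hn)
          (Real.exp_pos _).le

theorem mul_log_sub_le_log_factorial (m : ℕ) :
    m * Real.log m - m ≤ Real.log m.factorial := by
  rcases Nat.eq_zero_or_pos m with rfl | hm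
  · simp
  · have h := Stirling.le_log_factorial_stirling hm.ne'
    have h1 : 0 ≤ Real.log m := Real.log_nonneg (by exact_mod_cast hm)
    have h2 : 0 ≤ Real.log (2 * Real.pi) := Real.log_nonneg (by linarith [Real.pi_gt_three])
    linarith

theorem neg_mul_le_choose_two_mul_log_one_sub {lam : ℝ} (hlam : 0 < lam) {n : ℕ}
    (hn : 2 * lam ≤ n) :
    -(lam * n) ≤ n.choose 2 * Real.log (1 - lam / n) := by
  have hn0 : (0 : ℝ) < n := by linarith
  have hp : lam / n ≤ 1 / 2 := by
    rw [div_le_div_iff₀ hn0 two_pos]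
    linarith
  have hlog : -(2 * (lam / n)) ≤ Real.log (1 - lam / n) := by
    refine le_trans ?_ (Real.one_sub_inv_le_log_of_pos (by linarith))
    have hp0 : 0 < lam / n := by positivity
    rw [le_sub_comm, inv_le_iff_one_le_mul₀ (by linarith)]
    nlinarith
  have hchoose : (n.choose 2 : ℝ) ≤ n ^ 2 / 2 := by
    rw [Nat.cast_choose_two]
    nlinarith
  calc -(lam * n) = n ^ 2 / 2 * -(2 * (lam / n)) := by field_simp
    _ ≤ n.choose 2 * -(2 * (lam / n)) :=
        mul_le_mul_of_nonpos_right hchoose (by rw [neg_nonpos]; positivity)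
    _ ≤ _ := mul_le_mul_of_nonneg_left hlog (by positivity)

/-- Restriction of the expectation to the event `V_T ≥ 3 m`. The terms beyond the first two are
`O(n)` when `m` is of order `n`. -/
theorem le_log_partitionFunction {lam : ℝ} {g : ℝ → ℝ} (hlam : 0 < lam)
    (hg : MonotoneOn g (Set.Ici 0)) {n m : ℕ} (hn : 2 * lam ≤ n) (hm : 3 * m ≤ n) :
    n * Real.log n * g (3 * m / n) - m * Real.log n + 2 * m * Real.log (m / n) - 2 * m +
      3 * m * Real.log lam - lam * n ≤ Real.log (partitionFunction lam g n) := by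
  have : IsProbabilityMeasure (erdosRenyi lam n) := by unfold erdosRenyi; infer_instance
  have hn0 : (0 : ℝ) < n := by linarith
  have hlog : 0 ≤ Real.log n := Real.log_nonneg (by
    rw [Nat.one_le_cast]
    exact Nat.cast_pos.1 hn0)
  have hp1 : 0 < 1 - lam / n := by
    rw [sub_pos, div_lt_one hn0]
    linarith
  set ε := Real.exp (n * Real.log n * g (3 * m / n)) with hε
  have hprob := binomialRandom_real_le_verticesInTriangles_ge (V := Fin n) (m := m)
    (edgeProb lam n) (by simpa using hm)
  rw [coe_edgeProb hlam (by linarith), Fintype.card_fin] at hprob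
  have hZ : ε * ((m.factorial : ℝ) ^ 2 * ((lam / n) ^ (3 * m) * (1 - lam / n) ^ n.choose 2)) ≤
      partitionFunction lam g n := by
    calc _ ≤ ε * (erdosRenyi lam n).real {G | ε ≤
          Real.exp (n * Real.log n * g ((verticesInTriangles G : ℝ) / n))} := by
          refine mul_le_mul_of_nonneg_left (hprob.trans ?_) (Real.exp_pos _).le
          refine measureReal_mono fun G (hG : 3 * m ≤ verticesInTriangles G) => ?_
          refine Real.exp_le_exp.2 (mul_le_mul_of_nonneg_left ?_ (by positivity))
          refine hg (Set.mem_Ici.2 (by positivity)) (Set.mem_Ici.2 (by positivity)) ?_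
          gcongr
          exact_mod_cast hG
      _ ≤ _ := mul_meas_ge_le_integral_of_nonneg (.of_forall fun _ => (Real.exp_pos _).le)
          .of_finite _
  have hfac : (0 : ℝ) < m.factorial := by exact_mod_cast m.factorial_pos
  refine le_trans ?_ (Real.log_le_log (by positivity) hZ)
  rw [Real.log_mul (by positivity) (by positivity), Real.log_mul (by positivity) (by positivity),
    Real.log_mul (by positivity) (by positivity), Real.log_pow, Real.log_pow, Real.log_pow,
    hε, Real.log_exp, Real.log_div hlam.ne' hn0.ne']
  have h1 := mul_log_sub_le_log_factorial m
  have h2 := neg_mul_le_choose_two_mul_log_one_sub hlam hn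
  -- This also holds for `m = 0`, where both logarithms of `m` and `m / n` are `0`.
  have h3 : (m : ℝ) * Real.log m = m * Real.log n + m * Real.log (m / n) := by
    rcases Nat.eq_zero_or_pos m with rfl | hm
    · simp
    · rw [Real.log_div (by positivity) hn0.ne']
      ring
  push_cast
  linarith

/-! ### The limit -/

/-- The variational formula for monotone `g` for which the supremum of `g y - y / 3` over `y ≥ 0` is
attained at a point `x ∈ (0, 1]`. -/
theorem tendsto_log_partitionFunction {lam L x : ℝ} {g : ℝ → ℝ} (hlam : 0 < lam)
    (hg : MonotoneOn g (Set.Ici 0)) (hgL : ∀ y, 0 ≤ y → g y ≤ L + y / 3) (hx0 : 0 < x)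
    (hx1 : x ≤ 1) (hgx : L = g x - x / 3) (hcont : ContinuousAt g x) :
    Tendsto (fun n : ℕ => 1 / (n * Real.log n) * Real.log (partitionFunction lam g n)) atTop
      (𝓝 L) := by
  have hcast : Tendsto (fun n : ℕ => (n : ℝ)) atTop atTop := tendsto_natCast_atTop_atTop
  have hlog : Tendsto (fun n : ℕ => Real.log n) atTop atTop := Real.tendsto_log_atTop.comp hcast
  let m : ℕ → ℕ := fun n => ⌊x / 3 * n⌋₊
  let u : ℕ → ℝ := fun n => m n / n
  have hu : Tendsto u atTop (𝓝 (x / 3)) :=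
    (tendsto_nat_floor_mul_div_atTop (by positivity : 0 ≤ x / 3)).comp hcast
  have hlower : Tendsto (fun n : ℕ => g (3 * u n) - u n + (2 * (u n * Real.log (u n)) - 2 * u n +
      3 * u n * Real.log lam - lam) / Real.log n) atTop (𝓝 L) := by
    have h1 : Tendsto (fun n => g (3 * u n)) atTop (𝓝 (g x)) := by
      refine hcont.tendsto.comp ?_
      convert hu.const_mul 3 using 2
      ring
    have h2 : Tendsto (fun n => u n * Real.log (u n)) atTop (𝓝 (x / 3 * Real.log (x / 3))) :=
      hu.mul ((Real.continuousAt_log (by positivity)).tendsto.comp hu)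
    have h3 := ((((h2.const_mul 2).sub (hu.const_mul 2)).add
      ((hu.const_mul 3).mul_const (Real.log lam))).sub_const lam).div_atTop hlog
    convert (h1.sub hu).add h3 using 2
    rw [hgx, add_zero]
  have hupper : Tendsto (fun n : ℕ => L + lam ^ 3 * Real.exp (3 * lam ^ 2) / Real.log n) atTop
      (𝓝 L) := by
    simpa using (tendsto_const_nhds (x := L)).add (hlog.const_div_atTop _)
  refine tendsto_of_tendsto_of_tendsto_of_le_of_le' hlower hupper ?_ ?_
  · filter_upwards [hcast.eventually_ge_atTop (2 * lam), hlog.eventually_gt_atTop 0] with n hn hl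
    have hn0 : (0 : ℝ) < n := by linarith
    -- This is where `x ≤ 1` is needed: the `m` disjoint triangles have to fit into `n` vertices.
    have hm : 3 * m n ≤ n := by
      have h := Nat.floor_le (show 0 ≤ x / 3 * n by positivity)
      have h' : ((3 * m n : ℕ) : ℝ) ≤ n := by
        push_cast
        nlinarith
      exact_mod_cast h'
    have h := le_log_partitionFunction hlam hg hn hm
    rw [one_div, ← div_eq_inv_mul, le_div_iff₀ (by positivity)]
    refine le_trans (le_of_eq ?_) h
    simp only [u]
    rw [mul_div_assoc]
    field_simp
    ring
  · filter_upwards [hcast.eventually_ge_atTop lam, hlog.eventually_gt_atTop 0] with n hn hl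
    have hn0 : (0 : ℝ) < n := by linarith
    rw [one_div, ← div_eq_inv_mul, div_le_iff₀ (by positivity)]
    refine (log_partitionFunction_le hlam hgL hn).trans (le_of_eq ?_)
    field_simp

end TriangleERG

theorem corollary3p3 (lam α β : ℝ) (hlam : 0 < lam) (hα : α ∈ Set.Ioo (0 : ℝ) 1) (hβ : 0 < β)
    (hαβ : 3 * α * β < 1) :
    Tendsto
      (fun n : ℕ =>
        1 / (n * Real.log n) *
          Real.log (TriangleERG.partitionFunction lam (fun x : ℝ => β * x ^ α) n))
      atTop
      (𝓝 (β * (3 * α * β) ^ (-(α / (α - 1))) - 1 / 3 * (3 * α * β) ^ (-(1 / (α - 1))))) := by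
  obtain ⟨hα0, hα1⟩ := hα
  have hα1' : α - 1 < 0 := by linarith
  have hne : α - 1 ≠ 0 := hα1'.ne
  have hc : 0 < 3 * α * β := by positivity
  set x := (3 * α * β) ^ (-(1 / (α - 1))) with hx
  have hx0 : 0 < x := Real.rpow_pos_of_pos hc _
  have hx1 : x ≤ 1 := Real.rpow_le_one hc.le hαβ.le (by
    rw [neg_nonneg]
    exact div_nonpos_of_nonneg_of_nonpos zero_le_one hα1'.le)
  have hxα : (3 * α * β) ^ (-(α / (α - 1))) = x ^ α := by
    rw [hx, ← Real.rpow_mul hc.le]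
    congr 1
    ring
  -- The point `x` is critical: `α β x ^ (α - 1) = 1 / 3`.
  have hcrit : 3 * α * β * x ^ α = x := by
    rw [← hxα, hx]
    nth_rw 1 [← Real.rpow_one (3 * α * β)]
    rw [← Real.rpow_add hc]
    congr 1
    field_simp
    ring
  rw [hxα]
  refine TriangleERG.tendsto_log_partitionFunction hlam ?_ ?_ hx0 hx1 (by ring) ?_
  · intro a ha b _ hab
    exact mul_le_mul_of_nonneg_left (Real.rpow_le_rpow ha hab hα0.le) hβ.le
  · intro y hy
    -- Bernoulli's inequality for `(y / x) ^ α` is the tangent line of `y ^ α` at `x`.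
    have hbern := rpow_one_add_le_one_add_mul_self (s := y / x - 1)
      (by linarith [div_nonneg hy hx0.le]) hα0.le hα1.le
    rw [add_sub_cancel, Real.div_rpow hy hx0.le, div_le_iff₀ (Real.rpow_pos_of_pos hx0 _)] at hbern
    calc β * y ^ α ≤ β * ((1 + α * (y / x - 1)) * x ^ α) := mul_le_mul_of_nonneg_left hbern hβ.le
      _ = β * x ^ α + (3 * α * β * x ^ α) * (y / x - 1) / 3 := by ring
      _ = β * x ^ α - 1 / 3 * x + y / 3 := by
          rw [hcrit]
          field_simp
          ring
  · exact continuousAt_const.mul (Real.continuousAt_rpow_const _ _ (Or.inl hx0.ne'))
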